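/- Let $X=\{x_0,x_1\}$, let $\Omega=\mathbb C\setminus(\,]-\infty,0]\cup[1,+\infty[\,)$, and let $\mathcal H(\Omega)$ be the algebra of holomorphic functions on $\Omega$ with the topology of compact convergence. For words $w\in X^*$ define $\operatorname{Li}_w\in\mathcal H(\Omega)$ by $\operatorname{Li}_{x_0^n}(z)=\log^n(z)/n!$ for $n\ge 0$ (principal branch), $\operatorname{Li}_{x_1w}(z)=\int_0^z\operatorname{Li}_w(s)\frac{ds}{1-s}$ for every word $w$, and $\operatorname{Li}_{x_0w}(z)=\int_0^z\operatorname{Li}_w(s)\frac{ds}{s}$ for every word $w$ in which $x_1$ occurs; extend $\operatorname{Li}_\bullet$ linearly to the noncommutative polynomials $\mathbb C\langle X\rangle$. For a noncommutative series $S\in\mathbb C\langle\langle X\rangle\rangle$ write $S=\sum_{n\ge0}S_n$ with $S_n=\sum_{|w|=n}\langle S\mid w\rangle\,w$. Let $\mathrm{Dom}(\operatorname{Li}_\bullet)$ be the set of series $S$ for which the family $(\operatorname{Li}_{S_n})_{n\ge0}$ is summable in $\mathcal H(\Omega)$, i.e. its finite partial sums, taken along the finite subsets of $\mathbb N$ directed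 by inclusion, converge to a function in $\mathcal H(\Omega)$ uniformly on every compact subset of $\Omega$; for such $S$ put $\operatorname{Li}_S=\sum_{n\ge0}\operatorname{Li}_{S_n}$. Let ⧢ denote the shuffle product. For a letter $x$ let $\mathbb C^{\mathrm{rat}}\langle\langle x\rangle\rangle$ be the closure of $\mathbb C[x]$ under sum, concatenation product and Kleene star (of series without constant term). Then: 1. If $S,T\in\mathrm{Dom}(\operatorname{Li}_\bullet)$, then $S$ ⧢ $T\in\mathrm{Dom}(\operatorname{Li}_\bullet)$. 2. For all $S,T\in\mathrm{Dom}(\operatorname{Li}_\bullet)$, $\operatorname{Li}_{S ⧢ T}=\operatorname{Li}_S\cdot\operatorname{Li}_T$ on $\Omega$. 3. $\mathbb C\langle X\rangle$ ⧢ $\mathbb C^{\mathrm{rat}}\langle\langle x_0\rangle\rangle$ ⧢ $\mathbb C^{\mathrm{rat}}\langle\langle x_1\rangle\rangle\subset\mathrm{Dom}(\operatorname{Li}_\bullet)$, where the left-hand side is the linear span of all products $P$ ⧢ $R_0$ ⧢ $R_1$ with $P\in\mathbb C\langle X\rangle$ and $R_i\in\mathbb C^{\mathrm{rat}}\langle\langle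 x_i\rangle\rangle$. -/

import Mathlib

open Filter

/-- Noncommutative power series `ℂ⟨⟨X⟩⟩` over the alphabet `X = {x₀, x₁}`, the letter `xᵢ` being
`i : Fin 2` and words being lists of letters: `S w` is the coefficient `⟨S | w⟩`. -/
abbrev NCSeries : Type := List (Fin 2) → ℂ

namespace NCSeries

/-- The empty word `1_{X*}`, as a series. -/
def one : NCSeries := fun w => if w = [] then 1 else 0

/-- Concatenation (Cauchy) product: sum over the factorizations `w = u v`. -/
noncomputable def conc (S T : NCSeries) : NCSeries := fun w =>
  ∑ i ∈ Finset.range (w.length + 1), S (w.take i) * T (w.drop i)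

/-- Powers for the concatenation product. -/
noncomputable def concPow (S : NCSeries) : ℕ → NCSeries
  | 0 => one
  | n + 1 => conc S (concPow S n)

/-- The Kleene star `S* = 1 + S + S² + ⋯` of a series `S` with `⟨S | 1⟩ = 0`: then `Sⁿ` has no term
of length `< n`, so the coefficient at `w` only involves the powers `Sⁿ` with `n ≤ |w|`. -/
noncomputable def star (S : NCSeries) : NCSeries := fun w =>
  ∑ n ∈ Finset.range (w.length + 1), concPow S n w

/-- The series is a noncommutative polynomial, i.e. an element of `ℂ⟨X⟩`. -/
def IsPolynomial (S : NCSeries) : Prop := (Function.support S).Finite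

/-- `ℂ^rat⟨⟨Y⟩⟩` for a set of letters `Y ⊆ X`: the closure of the polynomials `ℂ⟨Y⟩` under the
rational operations sum, concatenation product and Kleene star (of series without constant term).
It is regarded inside `ℂ⟨⟨X⟩⟩`. -/
inductive IsRational (Y : Set (Fin 2)) : NCSeries → Prop
  | polynomial (P : NCSeries) (hP : IsPolynomial P) (hY : ∀ w, P w ≠ 0 → ∀ a ∈ w, a ∈ Y) :
      IsRational Y P
  | add (S T : NCSeries) (hS : IsRational Y S) (hT : IsRational Y T) : IsRational Y (S + T)
  | conc (S T : NCSeries) (hS : IsRational Y S) (hT : IsRational Y T) : IsRational Y (conc S T)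
  | star (S : NCSeries) (hS : IsRational Y S) (h0 : S [] = 0) : IsRational Y (star S)

/-- The list, with multiplicities, of the pairs `(u, v)` of complementary subwords of `w`: it lists
the terms `u ⊗ v` of `Δ_⧢(w)`, where `Δ_⧢` is the morphism for concatenation with
`Δ_⧢(x) = x ⊗ 1 + 1 ⊗ x` for every letter `x`. -/
def unshuffles : List (Fin 2) → List (List (Fin 2) × List (Fin 2))
  | [] => [([], [])]
  | a :: w =>
      (unshuffles w).map (fun p => (a :: p.1, p.2)) ++ (unshuffles w).map (fun p => (p.1, a :: p.2))

/-- The shuffle product `S ⧢ T`: `⟨S ⧢ T | w⟩ = ⟨S ⊗ T | Δ_⧢(w)⟩`, that is, every word `w` is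
counted once for each way of interleaving a word `u` of `S` with a word `v` of `T` into `w`. -/
noncomputable def shuffle (S T : NCSeries) : NCSeries := fun w =>
  ((unshuffles w).map (fun p => S p.1 * T p.2)).sum

end NCSeries

namespace Polylog

/-- The cleft plane `Ω = ℂ ∖ (]-∞, 0] ∪ [1, +∞[)`. -/
def Ω : Set ℂ := ((fun x : ℝ => (x : ℂ)) '' (Set.Iic 0 ∪ Set.Ici 1))ᶜ

/-- The polylogarithm `Li_w` of a word `w`, as an iterated integral for the differential forms
`ω₀ = ds / s` and `ω₁ = ds / (1 - s)`:
* `Li_w(z) = logⁿ(z) / n!` for `w = x₀ⁿ`, `n ≥ 0`;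
* `Li_{x₀ w}(z) = ∫_0^z Li_w(s) ds / s` if the letter `x₁` occurs in `w`;
* `Li_{x₁ w}(z) = ∫_0^z Li_w(s) ds / (1 - s)`.
The integrals are taken along the segment `s = t z`, `0 < t ≤ 1`, which lies in `Ω` if `z ∈ Ω`. -/
noncomputable def LiWord : List (Fin 2) → ℂ → ℂ
  | [] => fun _ => 1
  | a :: w => fun z =>
      if a = 1 then ∫ t in (0 : ℝ)..1, LiWord w ((t : ℂ) * z) * (z / (1 - (t : ℂ) * z))
      else if (1 : Fin 2) ∈ w then ∫ t in (0 : ℝ)..1, LiWord w ((t : ℂ) * z) * (1 / (t : ℂ))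
      else Complex.log z ^ (w.length + 1) / ((w.length + 1).factorial : ℂ)

/-- `Li_{Sₙ}`, where `Sₙ = ∑_{|w| = n} ⟨S | w⟩ w` is the homogeneous component of degree `n`
of `S`. -/
noncomputable def LiHom (S : NCSeries) (n : ℕ) (z : ℂ) : ℂ :=
  ∑ w : List.Vector (Fin 2) n, S w.toList * LiWord w.toList z

/-- `Dom(Li_•)`: the series `S` for which the family `(Li_{Sₙ})_{n ≥ 0}` is summable in the space
`ℋ(Ω)` of holomorphic functions on `Ω`, endowed with the topology of compact convergence, that is,
its finite partial sums converge, along the finite subsets of `ℕ` ordered by inclusion, to some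
`F ∈ ℋ(Ω)`, uniformly on every compact subset of `Ω`. -/
def DomLi : Set NCSeries :=
  {S | ∃ F : ℂ → ℂ, DifferentiableOn ℂ F Ω ∧ ∀ K ⊆ Ω, IsCompact K →
    TendstoUniformlyOn (fun (s : Finset ℕ) (z : ℂ) => ∑ n ∈ s, LiHom S n z) F atTop K}

/-- `Li_S = ∑_{n ≥ 0} Li_{Sₙ}`, for `S ∈ Dom(Li_•)`. -/
noncomputable def LiSeries (S : NCSeries) (z : ℂ) : ℂ := ∑' n : ℕ, LiHom S n z

/-- `ℂ⟨X⟩ ⧢ ℂ^rat⟨⟨x₀⟩⟩ ⧢ ℂ^rat⟨⟨x₁⟩⟩`: the linear span of the products `P ⧢ R₀ ⧢ R₁`. -/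
noncomputable def polyShuffleRat : Submodule ℂ NCSeries :=
  Submodule.span ℂ {S | ∃ P R₀ R₁ : NCSeries, NCSeries.IsPolynomial P ∧
    NCSeries.IsRational {0} R₀ ∧ NCSeries.IsRational {1} R₁ ∧
    S = NCSeries.shuffle (NCSeries.shuffle P R₀) R₁}

end Polylog

/-! ### The slit plane and integration along rays from the origin -/

namespace Polylog

open Topology MeasureTheory intervalIntegral

/-! The core is the finite identity `LiHom_shuffle`: in each degree `n`, `Li_{(S ⧢ T)_n}` is the sum
of `Li_{S_i} Li_{T_j}` over `i + j = n`. It is proved by induction on `n`. Removing the first letter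
of words is a derivation for the shuffle product, and `Li_{x_a w}` has derivative `Li_w` times the
density of `ω_a`, so both sides have the same derivative by the Leibniz rule and the induction
hypothesis. To see that no constant of integration appears, both sides are compared near `0` along
rays. The words `x₀ⁿ` give powers of `log`, whose contributions cancel exactly by the binomial
formula. Every other word contains `x₁`, and its polylogarithm vanishes at `0` fast enough to beat
any power of `log`. The growth is recorded by `RayBound`, with exponent `-1/3` for powers of `log`
and `2/3` for words containing `x₁`.

Parts 1 and 2 then concern Cauchy products. Convergence along all finite subsets forces absolute
convergence, uniformly on compact sets (`uniformAbsCauchyOn_of_tendstoUniformlyOn`), and this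
property passes to Cauchy products (`UniformAbsCauchyOn.cauchyProduct`).

For part 3, parts of the span are treated separately and combined by part 1 and linearity.
Polynomials have finitely many nonzero components. A rational series in one letter has coefficients
of at most geometric growth (`IsRational.geometricOn`), while `Li_{xⁿ}` is `O(Mⁿ / n!)` on a compact
set, so the Weierstrass test applies. -/

theorem isOpen_Ω : IsOpen Ω :=
  (Complex.isometry_ofReal.isClosedEmbedding.isClosedMap _ (isClosed_Iic.union isClosed_Ici)).isOpen_compl

theorem mem_Ω_iff {z : ℂ} : z ∈ Ω ↔ z.im ≠ 0 ∨ (0 < z.re ∧ z.re < 1) := by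
  simp only [Ω, Set.mem_compl_iff, Set.mem_image, Set.mem_union, Set.mem_Iic, Set.mem_Ici]
  constructor
  · intro h
    by_contra! hc
    refine h ⟨z.re, ?_, Complex.ext (by simp) (by simp [hc.1])⟩
    by_contra! h'
    exact absurd (hc.2 h'.1) (not_le.2 h'.2)
  · rintro h ⟨x, hx, rfl⟩
    simp only [Complex.ofReal_im, ne_eq, not_true_eq_false, Complex.ofReal_re, false_or] at h
    rcases hx with hx | hx <;> linarith

theorem ray_mem {z : ℂ} (hz : z ∈ Ω) {t : ℝ} (ht : t ∈ Set.Ioc (0 : ℝ) 1) : (t : ℂ) * z ∈ Ω := by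
  rw [mem_Ω_iff] at hz ⊢
  simp only [Complex.mul_im, Complex.ofReal_re, Complex.ofReal_im, zero_mul, add_zero,
    Complex.mul_re, sub_zero]
  rcases hz with h | h
  · exact Or.inl (mul_ne_zero ht.1.ne' h)
  · refine Or.inr ⟨mul_pos ht.1 h.1, ?_⟩
    nlinarith [ht.1, ht.2, h.1, h.2]

theorem ne_zero_of_mem_Ω {z : ℂ} (hz : z ∈ Ω) : z ≠ 0 := by
  rintro rfl
  simp [mem_Ω_iff] at hz

theorem one_sub_ne_zero_of_mem_Ω {z : ℂ} (hz : z ∈ Ω) : 1 - z ≠ 0 := by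
  intro h
  obtain rfl : z = 1 := (sub_eq_zero.1 h).symm
  simp [mem_Ω_iff] at hz

theorem mem_slitPlane_of_mem_Ω {z : ℂ} (hz : z ∈ Ω) : z ∈ Complex.slitPlane := by
  rw [mem_Ω_iff] at hz
  rw [Complex.mem_slitPlane_iff]
  tauto

theorem one_sub_ray_ne_zero {z : ℂ} (hz : z ∈ Ω) {t : ℝ} (ht : t ∈ Set.Icc (0 : ℝ) 1) :
    1 - (t : ℂ) * z ≠ 0 := by
  rcases ht.1.eq_or_lt with rfl | h
  · simp
  · exact one_sub_ne_zero_of_mem_Ω (ray_mem hz ⟨h, ht.2⟩)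

/-- `f (t z) = O(t ^ e)` for `t ∈ ]0, 1]`, locally uniformly in `z ∈ Ω`. -/
def RayBound (f : ℂ → ℂ) (e : ℝ) : Prop :=
  ∀ K ⊆ Ω, IsCompact K → ∃ C : ℝ, 0 ≤ C ∧
    ∀ z ∈ K, ∀ t ∈ Set.Ioc (0 : ℝ) 1, ‖f ((t : ℂ) * z)‖ ≤ C * t ^ e

/-- The integral of `h` along the segment from `0` to `z`. -/
noncomputable def rayIntegral (h : ℂ → ℂ) (z : ℂ) : ℂ := ∫ t in (0 : ℝ)..1, z * h ((t : ℂ) * z)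

/-- The substitution contributes one factor `s`, which raises the exponent by one; `-1/3 > -1` makes
the integral converge, with `∫₀¹ t^(-1/3) dt = 3/2`. -/
theorem RayBound.rayIntegral {h : ℂ → ℂ} (hb : RayBound h (-1 / 3)) :
    RayBound (rayIntegral h) (2 / 3) := by
  intro K hK hKc
  obtain ⟨C, hC0, hC⟩ := hb K hK hKc
  obtain ⟨M, hM⟩ := hKc.isBounded.exists_norm_le
  refine ⟨max M 0 * C * (3 / 2), by positivity, fun z hz s hs => ?_⟩
  have hi : IntervalIntegrable (fun t : ℝ => max M 0 * C * s ^ (2 / 3 : ℝ) * t ^ (-1 / 3 : ℝ))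
      volume 0 1 := (intervalIntegrable_rpow' (by norm_num)).const_mul _
  have hz0 : ‖z‖ ≤ max M 0 := (hM z hz).trans (le_max_left _ _)
  refine (norm_integral_le_of_norm_le zero_le_one (Eventually.of_forall ?_) hi).trans ?_
  · intro t ht
    have hts : t * s ∈ Set.Ioc (0 : ℝ) 1 :=
      ⟨mul_pos ht.1 hs.1, mul_le_one₀ ht.2 hs.1.le hs.2⟩
    have h1 := hC z hz _ hts
    rw [Real.mul_rpow ht.1.le hs.1.le] at h1
    have h2 : s * s ^ (-1 / 3 : ℝ) = s ^ (2 / 3 : ℝ) := by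
      nth_rewrite 1 [← Real.rpow_one s]
      rw [← Real.rpow_add hs.1]; norm_num
    calc ‖(s : ℂ) * z * h ((t : ℂ) * ((s : ℂ) * z))‖
        = s * ‖z‖ * ‖h (((t * s : ℝ) : ℂ) * z)‖ := by
          rw [norm_mul, norm_mul, Complex.norm_real, Real.norm_of_nonneg hs.1.le]
          push_cast; rw [mul_assoc (t : ℂ)]
      _ ≤ s * max M 0 * (C * (t ^ (-1 / 3 : ℝ) * s ^ (-1 / 3 : ℝ))) := by
          have := hs.1.le
          gcongr
      _ = max M 0 * C * (s * s ^ (-1 / 3 : ℝ)) * t ^ (-1 / 3 : ℝ) := by ring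
      _ = _ := by rw [h2]
  · rw [intervalIntegral.integral_const_mul, integral_rpow (by norm_num)]
    norm_num
    apply le_of_eq; ring

theorem continuousOn_ray {h : ℂ → ℂ} (hh : ContinuousOn h Ω) {z : ℂ} (hz : z ∈ Ω) :
    ContinuousOn (fun t : ℝ => h ((t : ℂ) * z)) (Set.Ioc 0 1) :=
  hh.comp (by fun_prop) fun _ ht => ray_mem hz ht

theorem tendsto_rpow_nhdsGT_zero {e : ℝ} (he : 0 < e) :
    Tendsto (fun t : ℝ => t ^ e) (𝓝[>] 0) (𝓝 0) := by
  have := (Real.continuousAt_rpow_const 0 e (Or.inr he.le)).tendsto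
  rw [Real.zero_rpow he.ne'] at this
  exact this.mono_left nhdsWithin_le_nhds

theorem RayBound.tendsto_zero {f : ℂ → ℂ} {e : ℝ} (hf : RayBound f e) (he : 0 < e) {z : ℂ}
    (hz : z ∈ Ω) : Tendsto (fun t : ℝ => f ((t : ℂ) * z)) (𝓝[>] 0) (𝓝 0) := by
  obtain ⟨C, -, hC⟩ := hf {z} (by simpa using hz) isCompact_singleton
  have h1 := (tendsto_rpow_nhdsGT_zero he).const_mul C
  rw [mul_zero] at h1
  refine squeeze_zero_norm' ?_ h1
  filter_upwards [Ioc_mem_nhdsGT (zero_lt_one' ℝ)] with t ht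
  exact hC z rfl t ht

/-- Under the integral sign, the `z`-derivative of `z h(tz)` equals the `t`-derivative of `t h(tz)`.
The latter integrates to `h z`, because `t h(tz) = O(t^(2/3))` vanishes at `0`. -/
theorem hasDerivAt_rayIntegral {h : ℂ → ℂ} (hd : DifferentiableOn ℂ h Ω)
    (hb : RayBound h (-1 / 3)) {z : ℂ} (hz : z ∈ Ω) : HasDerivAt (rayIntegral h) (h z) z := by
  obtain ⟨ε, hε, hball⟩ := Metric.isOpen_iff.1 isOpen_Ω z hz
  -- Circles of radius `r` centred in `ball z r` stay in `closedBall z (2 * r) ⊆ Ω`, so Cauchy's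
  -- estimate there dominates the derivative.
  set r := ε / 4 with hr
  have hr0 : 0 < r := by positivity
  have hKΩ : Metric.closedBall z (2 * r) ⊆ Ω :=
    (Metric.closedBall_subset_ball (by rw [hr]; linarith)).trans hball
  obtain ⟨C, hC0, hC⟩ := hb _ hKΩ (isCompact_closedBall _ _)
  have hda : ∀ w ∈ Ω, HasDerivAt h (deriv h w) w := fun w hw =>
    (hd.differentiableAt (isOpen_Ω.mem_nhds hw)).hasDerivAt
  have hderiv : ∀ t ∈ Set.Ioc (0 : ℝ) 1, ∀ x ∈ Ω,
      HasDerivAt (fun x : ℂ => x * h ((t : ℂ) * x))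
        (h ((t : ℂ) * x) + x * (deriv h ((t : ℂ) * x) * t)) x := by
    intro t ht x hx
    have h1 : HasDerivAt (fun x : ℂ => (t : ℂ) * x) (t : ℂ) x := by
      simpa using (hasDerivAt_id x).const_mul (t : ℂ)
    have h2 := (hasDerivAt_id' x).mul ((hda _ (ray_mem hx ht)).comp x h1)
    rw [one_mul] at h2
    exact h2
  have hcont : ∀ x ∈ Ω, ContinuousOn (fun t : ℝ => x * h ((t : ℂ) * x)) (Set.Ioc 0 1) :=
    fun x hx => continuousOn_const.mul (continuousOn_ray hd.continuousOn hx)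
  have hmeas : ∀ x ∈ Ω, AEStronglyMeasurable (fun t : ℝ => x * h ((t : ℂ) * x))
      (volume.restrict (Set.uIoc 0 1)) := fun x hx => by
    rw [Set.uIoc_of_le zero_le_one]
    exact (hcont x hx).aestronglyMeasurable measurableSet_Ioc
  have hbd : ∀ t ∈ Set.Ioc (0 : ℝ) 1, ∀ x ∈ Metric.closedBall z (2 * r),
      ‖x * h ((t : ℂ) * x)‖ ≤ (‖z‖ + 2 * r) * C * t ^ (-1 / 3 : ℝ) := by
    intro t ht x hx
    rw [norm_mul, mul_assoc]
    have hx' : ‖x‖ ≤ ‖z‖ + 2 * r := by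
      have := norm_le_norm_add_norm_sub' x z
      rw [mem_closedBall_iff_norm] at hx
      linarith
    exact mul_le_mul hx' (hC x hx t ht) (norm_nonneg _) (by positivity)
  have hii : ∀ c : ℝ, IntervalIntegrable (fun t : ℝ => c * t ^ (-1 / 3 : ℝ)) volume 0 1 :=
    fun c => (intervalIntegrable_rpow' (by norm_num)).const_mul _
  have hzK : z ∈ Metric.closedBall z (2 * r) := Metric.mem_closedBall_self (by positivity)
  have key := hasDerivAt_integral_of_dominated_loc_of_deriv_le (μ := volume) (a := 0) (b := 1)
    (F := fun x t => x * h ((t : ℂ) * x))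
    (F' := fun x t => h ((t : ℂ) * x) + x * (deriv h ((t : ℂ) * x) * t))
    (bound := fun t => (‖z‖ + 2 * r) * C / r * t ^ (-1 / 3 : ℝ))
    (x₀ := z) (s := Metric.ball z r) (Metric.ball_mem_nhds z hr0)
    ?_ ?_ ?_ ?_ (hii _) ?_
  · obtain ⟨hint, hD⟩ := key
    have hval : ∫ t in (0 : ℝ)..1, (h ((t : ℂ) * z) + z * (deriv h ((t : ℂ) * z) * t)) = h z := by
      rw [integral_eq_sub_of_hasDerivAt_of_tendsto (f := fun t : ℝ => (t : ℂ) * h ((t : ℂ) * z))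
        (fa := 0) (fb := h z) zero_lt_one ?_ hint ?_ ?_, sub_zero]
      · intro t ht
        have h1 : HasDerivAt (fun t : ℝ => (t : ℂ)) 1 t := Complex.ofRealCLM.hasDerivAt
        have h2 := (hda _ (ray_mem hz ⟨ht.1, ht.2.le⟩)).comp t (h1.mul_const z)
        refine (h1.mul h2).congr_deriv ?_
        change 1 * h ((t : ℂ) * z) + (t : ℂ) * (deriv h ((t : ℂ) * z) * (1 * z)) = _
        ring
      · have h1 := ((tendsto_rpow_nhdsGT_zero (e := 2 / 3) (by norm_num)).const_mul C)
        rw [mul_zero] at h1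
        refine squeeze_zero_norm' ?_ h1
        filter_upwards [Ioc_mem_nhdsGT (zero_lt_one' ℝ)] with t ht
        have h2 : t * t ^ (-1 / 3 : ℝ) = t ^ (2 / 3 : ℝ) := by
          nth_rewrite 1 [← Real.rpow_one t]
          rw [← Real.rpow_add ht.1]; norm_num
        rw [norm_mul, Complex.norm_real, Real.norm_of_nonneg ht.1.le, ← h2, mul_left_comm]
        exact mul_le_mul_of_nonneg_left (hC z hzK t ht) ht.1.le
      · have h1 : ContinuousAt (fun t : ℝ => (t : ℂ) * h ((t : ℂ) * z)) 1 := by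
          have h2 : ContinuousAt h (((1 : ℝ) : ℂ) * z) := by
            simpa using (hda z hz).continuousAt
          refine Complex.continuous_ofReal.continuousAt.mul
            (ContinuousAt.comp (f := fun t : ℝ => (t : ℂ) * z) h2 (by fun_prop))
        simpa using h1.tendsto.mono_left (nhdsWithin_le_nhds (s := Set.Iio (1 : ℝ)))
    rw [hval] at hD
    exact hD
  · filter_upwards [isOpen_Ω.mem_nhds hz] with x hx
    exact hmeas x hx
  · refine (hii ((‖z‖ + 2 * r) * C)).mono_fun (hmeas z hz) ?_
    rw [Set.uIoc_of_le zero_le_one]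
    filter_upwards [ae_restrict_mem measurableSet_Ioc] with t ht
    exact (hbd t ht z hzK).trans (le_abs_self _)
  · rw [Set.uIoc_of_le zero_le_one]
    refine ContinuousOn.aestronglyMeasurable ?_ measurableSet_Ioc
    refine (continuousOn_ray hd.continuousOn hz).add (continuousOn_const.mul
      ((continuousOn_ray (hd.deriv isOpen_Ω).continuousOn hz).mul ?_))
    fun_prop
  · refine Eventually.of_forall fun t ht x hx => ?_
    rw [Set.uIoc_of_le zero_le_one] at ht
    have hsub : Metric.closedBall x r ⊆ Metric.closedBall z (2 * r) := by
      refine Metric.closedBall_subset_closedBall' ?_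
      have := (Metric.mem_ball.1 hx).le
      linarith
    have hxΩ : x ∈ Ω := hKΩ (hsub (Metric.mem_closedBall_self hr0.le))
    rw [← (hderiv t ht x hxΩ).deriv]
    refine (Complex.norm_deriv_le_of_forall_mem_sphere_norm_le hr0 ?_ (C :=
      (‖z‖ + 2 * r) * C * t ^ (-1 / 3 : ℝ)) ?_).trans (le_of_eq (by ring))
    · refine DifferentiableOn.diffContOnCl fun y hy => ?_
      refine (hderiv t ht y (hKΩ (hsub ?_))).differentiableAt.differentiableWithinAt
      exact Metric.closure_ball_subset_closedBall hy
    · exact fun y hy => hbd t ht y (hsub (Metric.sphere_subset_closedBall hy))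
  · refine Eventually.of_forall fun t ht x hx => ?_
    rw [Set.uIoc_of_le zero_le_one] at ht
    exact hderiv t ht x (hKΩ (Metric.ball_subset_closedBall
      (Metric.ball_subset_ball (by linarith) hx)))

end Polylog

/-! ### Growth at the origin and derivatives of polylogarithms of words -/

namespace Polylog

open Topology MeasureTheory intervalIntegral

theorem RayBound.mono {f : ℂ → ℂ} {e e' : ℝ} (hf : RayBound f e) (h : e' ≤ e) :
    RayBound f e' := by
  intro K hK hKc
  obtain ⟨C, hC0, hC⟩ := hf K hK hKc
  exact ⟨C, hC0, fun z hz t ht => (hC z hz t ht).trans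
    (mul_le_mul_of_nonneg_left (Real.rpow_le_rpow_of_exponent_ge ht.1 ht.2 h) hC0)⟩

theorem RayBound.mul {f g : ℂ → ℂ} {e e' : ℝ} (hf : RayBound f e) (hg : RayBound g e') :
    RayBound (fun z => f z * g z) (e + e') := by
  intro K hK hKc
  obtain ⟨C, hC0, hC⟩ := hf K hK hKc
  obtain ⟨D, hD0, hD⟩ := hg K hK hKc
  refine ⟨C * D, by positivity, fun z hz t ht => ?_⟩
  rw [norm_mul, Real.rpow_add ht.1, mul_mul_mul_comm]
  exact mul_le_mul (hC z hz t ht) (hD z hz t ht) (norm_nonneg _)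
    (mul_nonneg hC0 (Real.rpow_nonneg ht.1.le _))

theorem RayBound.add {f g : ℂ → ℂ} {e : ℝ} (hf : RayBound f e) (hg : RayBound g e) :
    RayBound (fun z => f z + g z) e := by
  intro K hK hKc
  obtain ⟨C, hC0, hC⟩ := hf K hK hKc
  obtain ⟨D, hD0, hD⟩ := hg K hK hKc
  refine ⟨C + D, by positivity, fun z hz t ht => ?_⟩
  rw [add_mul]
  exact (norm_add_le _ _).trans (add_le_add (hC z hz t ht) (hD z hz t ht))

theorem RayBound.const_mul {f : ℂ → ℂ} {e : ℝ} (hf : RayBound f e) (c : ℂ) :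
    RayBound (fun z => c * f z) e := by
  intro K hK hKc
  obtain ⟨C, hC0, hC⟩ := hf K hK hKc
  refine ⟨‖c‖ * C, by positivity, fun z hz t ht => ?_⟩
  rw [norm_mul, mul_assoc]
  exact mul_le_mul_of_nonneg_left (hC z hz t ht) (norm_nonneg _)

theorem rayBound_zero (e : ℝ) : RayBound (fun _ => 0) e := fun _ _ _ =>
  ⟨0, le_rfl, fun z hz t ht => by simp⟩

theorem RayBound.sum {ι : Type*} (s : Finset ι) {f : ι → ℂ → ℂ} {e : ℝ}
    (hf : ∀ i ∈ s, RayBound (f i) e) : RayBound (fun z => ∑ i ∈ s, f i z) e := by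
  classical
  induction s using Finset.induction_on with
  | empty => simpa using rayBound_zero e
  | insert a s ha ih =>
    simp only [Finset.sum_insert ha]
    exact (hf a (Finset.mem_insert_self _ _)).add
      (ih fun i hi => hf i (Finset.mem_insert_of_mem hi))

theorem rayBound_log_pow (n : ℕ) : RayBound (fun z => Complex.log z ^ n) (-1 / 3) := by
  intro K hK hKc
  rcases Nat.eq_zero_or_pos n with rfl | hn
  · refine ⟨1, zero_le_one, fun z hz t ht => ?_⟩
    simpa using Real.one_le_rpow_of_pos_of_le_one_of_nonpos ht.1 ht.2 (by norm_num : (-1/3:ℝ) ≤ 0)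
  have hc : ContinuousOn Complex.log K := fun z hz =>
    (Complex.differentiableAt_log (mem_slitPlane_of_mem_Ω (hK hz))).continuousAt.continuousWithinAt
  obtain ⟨M, hM⟩ := hKc.exists_bound_of_continuousOn hc
  -- Since `|log t| ≤ t^(-δ) / δ`, this choice makes the `n`-th power `O(t^(-1/3))`.
  set δ : ℝ := 1 / (3 * n) with hδ
  have hn' : (0 : ℝ) < n := by exact_mod_cast hn
  have hδ0 : 0 < δ := by positivity
  refine ⟨(1 / δ + max M 0) ^ n, by positivity, fun z hz t ht => ?_⟩
  have h1 : |Real.log t| ≤ 1 / δ * t ^ (-δ) := by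
    have h2 := (Real.abs_log_mul_self_rpow_lt t δ ht.1 ht.2 hδ0).le
    have h3 : 0 < t ^ δ := Real.rpow_pos_of_pos ht.1 _
    rw [abs_mul, abs_of_pos h3] at h2
    rw [Real.rpow_neg ht.1.le]
    rwa [← div_eq_mul_inv, le_div_iff₀ h3]
  have h2 : 1 ≤ t ^ (-δ) :=
    Real.one_le_rpow_of_pos_of_le_one_of_nonpos ht.1 ht.2 (by linarith)
  have h3 : ‖Complex.log ((t : ℂ) * z)‖ ≤ (1 / δ + max M 0) * t ^ (-δ) := by
    rw [Complex.log_ofReal_mul ht.1 (ne_zero_of_mem_Ω (hK hz)), add_mul]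
    refine (norm_add_le _ _).trans (add_le_add ?_ ?_)
    · rwa [Complex.norm_real, Real.norm_eq_abs]
    · calc _ ≤ max M 0 := (hM z hz).trans (le_max_left _ _)
        _ ≤ _ := le_mul_of_one_le_right (le_max_right _ _) h2
  rw [norm_pow]
  refine (pow_le_pow_left₀ (norm_nonneg _) h3 n).trans (le_of_eq ?_)
  rw [mul_pow, ← Real.rpow_natCast (t ^ (-δ)), ← Real.rpow_mul ht.1.le]
  congr 2
  rw [hδ]; field_simp

/-- The density of the differential form `ω₀ = ds / s` or `ω₁ = ds / (1 - s)`. -/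
noncomputable def formDensity (a : Fin 2) (s : ℂ) : ℂ := if a = 1 then 1 / (1 - s) else 1 / s

theorem differentiableOn_formDensity (a : Fin 2) : DifferentiableOn ℂ (formDensity a) Ω := by
  intro z hz
  unfold formDensity
  split_ifs
  · exact ((differentiableAt_const _).div (by fun_prop)
      (one_sub_ne_zero_of_mem_Ω hz)).differentiableWithinAt
  · exact ((differentiableAt_const _).div (by fun_prop)
      (ne_zero_of_mem_Ω hz)).differentiableWithinAt

theorem exists_bound_one_sub_ray {K : Set ℂ} (hK : K ⊆ Ω) (hKc : IsCompact K) :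
    ∃ C : ℝ, 0 ≤ C ∧ ∀ z ∈ K, ∀ t ∈ Set.Icc (0 : ℝ) 1, ‖1 / (1 - (t : ℂ) * z)‖ ≤ C := by
  have hc : ContinuousOn (fun p : ℝ × ℂ => 1 / (1 - (p.1 : ℂ) * p.2)) (Set.Icc 0 1 ×ˢ K) :=
    continuousOn_const.div (by fun_prop) fun p hp => one_sub_ray_ne_zero (hK hp.2) hp.1
  obtain ⟨C, hC⟩ := (isCompact_Icc.prod hKc).exists_bound_of_continuousOn hc
  exact ⟨max C 0, le_max_right _ _, fun z hz t ht => (hC (t, z) ⟨ht, hz⟩).trans (le_max_left _ _)⟩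

/-- `ω₁` is regular at `0`. The exponent `0` is needed when `x₁` precedes a power of `x₀`: exponent
`-1` would leave a non-integrable bound. -/
theorem rayBound_formDensity_one : RayBound (formDensity 1) 0 := by
  intro K hK hKc
  obtain ⟨C, hC0, hC⟩ := exists_bound_one_sub_ray hK hKc
  exact ⟨C, hC0, fun z hz t ht => by
    simpa [formDensity] using hC z hz t ⟨ht.1.le, ht.2⟩⟩

theorem rayBound_formDensity (a : Fin 2) : RayBound (formDensity a) (-1) := by
  by_cases ha : a = 1
  · subst ha
    exact rayBound_formDensity_one.mono (by norm_num)
  intro K hK hKc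
  have hc : ContinuousOn (fun z : ℂ => 1 / z) K :=
    continuousOn_const.div continuousOn_id fun z hz => ne_zero_of_mem_Ω (hK hz)
  obtain ⟨C, hC⟩ := hKc.exists_bound_of_continuousOn hc
  refine ⟨max C 0, le_max_right _ _, fun z hz t ht => ?_⟩
  have h1 := (hC z hz).trans (le_max_left _ 0)
  simp only [formDensity, ha, if_false]
  rw [Real.rpow_neg_one, one_div, mul_inv_rev, ← one_div z, norm_mul, norm_inv, Complex.norm_real,
    Real.norm_of_nonneg ht.1.le]
  exact mul_le_mul_of_nonneg_right h1 (inv_nonneg.2 ht.1.le)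

theorem LiWord_of_one_notMem {w : List (Fin 2)} (hw : (1 : Fin 2) ∉ w) (z : ℂ) :
    LiWord w z = Complex.log z ^ w.length / (w.length.factorial : ℂ) := by
  cases w with
  | nil => simp [LiWord]
  | cons a w =>
    simp only [List.mem_cons, not_or] at hw
    simp [LiWord, hw.2, Ne.symm hw.1]

theorem LiWord_cons_of_one_mem {a : Fin 2} {w : List (Fin 2)} (h : (1 : Fin 2) ∈ a :: w)
    {z : ℂ} (hz : z ∈ Ω) :
    LiWord (a :: w) z = rayIntegral (fun s => LiWord w s * formDensity a s) z := by
  have hz0 := ne_zero_of_mem_Ω hz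
  by_cases ha : a = 1
  · subst ha
    simp only [LiWord, rayIntegral, formDensity, if_true]
    exact intervalIntegral.integral_congr fun t _ => by ring
  · have hw : (1 : Fin 2) ∈ w := by
      rcases List.mem_cons.1 h with h | h
      · exact absurd h.symm ha
      · exact h
    simp only [LiWord, rayIntegral, formDensity, ha, hw, if_true, if_false]
    refine intervalIntegral.integral_congr fun t _ => ?_
    simp only [one_div, mul_inv]
    field_simp

theorem RayBound.congr {f g : ℂ → ℂ} {e : ℝ} (hf : RayBound f e) (h : Set.EqOn g f Ω) :
    RayBound g e := by
  intro K hK hKc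
  obtain ⟨C, hC0, hC⟩ := hf K hK hKc
  refine ⟨C, hC0, fun z hz t ht => ?_⟩
  rw [h (ray_mem (hK hz) ht)]
  exact hC z hz t ht

theorem rayBound_LiWord_of_one_notMem {w : List (Fin 2)} (hw : (1 : Fin 2) ∉ w) :
    RayBound (LiWord w) (-1 / 3) :=
  ((rayBound_log_pow w.length).const_mul (w.length.factorial : ℂ)⁻¹).congr fun z _ => by
    simp only [LiWord_of_one_notMem hw, div_eq_inv_mul]

/-- The exponents close up under induction. The integrand has exponent `2/3 - 1` if `x₁` occurs in
the tail, and `-1/3 + 0` if `x₁` is only the first letter; integration returns `-1/3` to `2/3`. The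
integrand bound is kept because differentiating the integral requires it. -/
theorem rayBound_LiWord_of_one_mem {w : List (Fin 2)} (hw : (1 : Fin 2) ∈ w) :
    RayBound (LiWord w) (2 / 3) ∧ ∀ {a u}, w = a :: u →
      RayBound (fun s => LiWord u s * formDensity a s) (-1 / 3) := by
  induction w with
  | nil => simp at hw
  | cons a w ih =>
    have key : RayBound (fun s => LiWord w s * formDensity a s) (-1 / 3) := by
      by_cases h : (1 : Fin 2) ∈ w
      · exact ((ih h).1.mul (rayBound_formDensity a)).mono (by norm_num)
      · obtain rfl : 1 = a := (List.mem_cons.1 hw).resolve_right h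
        exact ((rayBound_LiWord_of_one_notMem h).mul rayBound_formDensity_one).mono (by norm_num)
    refine ⟨key.rayIntegral.congr fun z hz => LiWord_cons_of_one_mem hw hz, ?_⟩
    rintro _ _ ⟨⟩
    exact key

theorem hasDerivAt_LiWord_cons_of_differentiableOn {a : Fin 2} {w : List (Fin 2)}
    (hd : DifferentiableOn ℂ (LiWord w) Ω) {z : ℂ} (hz : z ∈ Ω) :
    HasDerivAt (LiWord (a :: w)) (LiWord w z * formDensity a z) z := by
  by_cases h : (1 : Fin 2) ∈ a :: w
  · refine (hasDerivAt_rayIntegral (hd.mul (differentiableOn_formDensity a))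
      ((rayBound_LiWord_of_one_mem h).2 rfl) hz).congr_of_eventuallyEq ?_
    filter_upwards [isOpen_Ω.mem_nhds hz] with y hy
    exact LiWord_cons_of_one_mem h hy
  · have h' := h
    simp only [List.mem_cons, not_or] at h'
    have h1 : LiWord (a :: w) = fun z =>
        Complex.log z ^ (w.length + 1) / ((w.length + 1).factorial : ℂ) :=
      funext fun z => LiWord_of_one_notMem h z
    rw [h1, LiWord_of_one_notMem h'.2]
    refine (((Complex.hasDerivAt_log (mem_slitPlane_of_mem_Ω hz)).pow (w.length + 1)).div_const
      _).congr_deriv ?_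
    have hz0 := ne_zero_of_mem_Ω hz
    have hf : (w.length.factorial : ℂ) ≠ 0 := by exact_mod_cast w.length.factorial_ne_zero
    have hn : ((w.length : ℂ) + 1) ≠ 0 := by exact_mod_cast w.length.succ_ne_zero
    simp only [formDensity, Ne.symm h'.1, if_false, Nat.factorial_succ]
    push_cast
    field_simp

theorem differentiableOn_LiWord (w : List (Fin 2)) : DifferentiableOn ℂ (LiWord w) Ω := by
  induction w with
  | nil => exact differentiableOn_const _
  | cons a w ih => exact fun z hz =>
      (hasDerivAt_LiWord_cons_of_differentiableOn ih hz).differentiableAt.differentiableWithinAt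

theorem hasDerivAt_LiWord_cons (a : Fin 2) (w : List (Fin 2)) {z : ℂ} (hz : z ∈ Ω) :
    HasDerivAt (LiWord (a :: w)) (LiWord w z * formDensity a z) z :=
  hasDerivAt_LiWord_cons_of_differentiableOn (differentiableOn_LiWord w) hz

end Polylog

/-! ### Left derivatives of the shuffle product -/

namespace NCSeries

/-- The left derivative `x_a ◁ S`, whose coefficient at `u` is `⟨S | x_a u⟩`. -/
def leftDeriv (a : Fin 2) (S : NCSeries) : NCSeries := fun u => S (a :: u)

theorem shuffle_nil (S T : NCSeries) : shuffle S T [] = S [] * T [] := by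
  simp [shuffle, unshuffles]

/-- Left derivatives are derivations for the shuffle product; this is the algebraic counterpart of
the Leibniz rule for products of polylogarithms. -/
theorem shuffle_cons (S T : NCSeries) (a : Fin 2) (w : List (Fin 2)) :
    shuffle S T (a :: w) = shuffle (leftDeriv a S) T w + shuffle S (leftDeriv a T) w := by
  simp [shuffle, unshuffles, leftDeriv, List.map_map, Function.comp_def]

theorem shuffle_replicate (S T : NCSeries) (a : Fin 2) (n : ℕ) :
    shuffle S T (List.replicate n a) = ∑ ij ∈ Finset.HasAntidiagonal.antidiagonal n,
      (n.choose ij.1 : ℂ) * (S (List.replicate ij.1 a) * T (List.replicate ij.2 a)) := by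
  induction n generalizing S T with
  | zero => simp [shuffle_nil]
  | succ n ih =>
    rw [Finset.sum_antidiagonal_choose_succ_mul
      (fun i j => S (List.replicate i a) * T (List.replicate j a)), List.replicate_succ,
      shuffle_cons, ih, ih, add_comm]
    congr 1
    refine Finset.sum_congr rfl fun ij hij => ?_
    rw [Finset.HasAntidiagonal.mem_antidiagonal] at hij
    rw [← Nat.choose_symm_of_eq_add (by omega : n = ij.2 + ij.1)]
    simp [leftDeriv, List.replicate_succ]

end NCSeries

/-! ### The shuffle identity in each degree -/

namespace Polylog

open Topology MeasureTheory intervalIntegral NCSeries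

/-- The sum of `f` over the words of length `n`. -/
noncomputable def wordSum (f : List (Fin 2) → ℂ) (n : ℕ) : ℂ :=
  ∑ w : List.Vector (Fin 2) n, f w.toList

theorem wordSum_zero (f : List (Fin 2) → ℂ) : wordSum f 0 = f [] := by
  rw [wordSum, Fintype.sum_eq_single List.Vector.nil fun w hw => absurd w.eq_nil hw]
  rfl

theorem wordSum_succ (f : List (Fin 2) → ℂ) (n : ℕ) :
    wordSum f (n + 1) = ∑ a, wordSum (fun w => f (a :: w)) n := by
  simp only [wordSum]
  rw [← Fintype.sum_prod_type' (f := fun a (w : List.Vector (Fin 2) n) => f (a :: w.toList))]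
  symm
  refine Fintype.sum_bijective (fun p : Fin 2 × List.Vector (Fin 2) n => p.1 ::ᵥ p.2)
    ⟨?_, fun w => ⟨(w.head, w.tail), List.Vector.cons_head_tail w⟩⟩ _ _ ?_
  · rintro ⟨a, u⟩ ⟨b, v⟩ h
    obtain ⟨h1, h2⟩ := (List.Vector.eq_cons_iff _ _ _).1 h
    simp at h1 h2
    rw [h1, h2]
  · rintro ⟨a, u⟩
    simp

theorem wordSum_eq_replicate_add (f : List (Fin 2) → ℂ) (n : ℕ) :
    wordSum f n = f (List.replicate n 0) + wordSum (fun w => if 1 ∈ w then f w else 0) n := by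
  induction n generalizing f with
  | zero => simp [wordSum_zero]
  | succ n ih =>
    simp only [wordSum_succ, Fin.sum_univ_two]
    rw [ih (fun w => f (0 :: w))]
    simp [List.replicate_succ, add_assoc]

theorem LiHom_eq_wordSum (S : NCSeries) (n : ℕ) (z : ℂ) :
    LiHom S n z = wordSum (fun w => S w * LiWord w z) n := rfl

theorem LiHom_zero (S : NCSeries) (z : ℂ) : LiHom S 0 z = S [] := by
  simp [LiHom_eq_wordSum, wordSum_zero, LiWord]

theorem LiHom_add (S T : NCSeries) (n : ℕ) (z : ℂ) :
    LiHom (S + T) n z = LiHom S n z + LiHom T n z := by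
  simp [LiHom, add_mul, Finset.sum_add_distrib]

theorem LiHom_smul (c : ℂ) (S : NCSeries) (n : ℕ) (z : ℂ) :
    LiHom (c • S) n z = c * LiHom S n z := by
  simp [LiHom, Finset.mul_sum, mul_assoc]

theorem differentiableOn_LiHom (S : NCSeries) (n : ℕ) : DifferentiableOn ℂ (LiHom S n) Ω :=
  DifferentiableOn.fun_sum fun w _ => (differentiableOn_LiWord w.toList).const_mul _

/-- The derivative of `Li_{Sₙ}`. -/
noncomputable def derivLiHom (S : NCSeries) : ℕ → ℂ → ℂ
  | 0, _ => 0
  | n + 1, z => ∑ a, LiHom (leftDeriv a S) n z * formDensity a z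

theorem hasDerivAt_LiHom (S : NCSeries) (n : ℕ) {z : ℂ} (hz : z ∈ Ω) :
    HasDerivAt (LiHom S n) (derivLiHom S n z) z := by
  cases n with
  | zero =>
    rw [show LiHom S 0 = fun _ => S [] from funext (LiHom_zero S)]
    exact hasDerivAt_const z _
  | succ n =>
    have h1 : LiHom S (n + 1) = fun z => ∑ a : Fin 2, ∑ w : List.Vector (Fin 2) n,
        S (a :: w.toList) * LiWord (a :: w.toList) z :=
      funext fun z => wordSum_succ (fun w => S w * LiWord w z) n
    rw [h1]
    refine (HasDerivAt.fun_sum fun a _ => HasDerivAt.fun_sum fun w _ =>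
      (hasDerivAt_LiWord_cons a w.toList hz).const_mul (S (a :: w.toList))).congr_deriv ?_
    simp [derivLiHom, LiHom, leftDeriv, Finset.sum_mul, mul_assoc]

/-- The contribution of the word `x₀ⁿ` to `Li_{Sₙ}`. -/
noncomputable def logPart (S : NCSeries) (n : ℕ) (z : ℂ) : ℂ :=
  S (List.replicate n 0) * (Complex.log z ^ n / (n.factorial : ℂ))

theorem rayBound_logPart (S : NCSeries) (n : ℕ) : RayBound (logPart S n) (-1 / 3) :=
  ((rayBound_log_pow n).const_mul (S (List.replicate n 0) * (n.factorial : ℂ)⁻¹)).congr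
    fun z _ => by simp only [logPart]; ring

/-- The binomial coefficients of the shuffle turn `1 / n!` into `1 / (i! j!)`, so the divergent
logarithmic terms match exactly. -/
theorem logPart_shuffle (S T : NCSeries) (n : ℕ) (z : ℂ) :
    logPart (shuffle S T) n z =
      ∑ ij ∈ Finset.HasAntidiagonal.antidiagonal n, logPart S ij.1 z * logPart T ij.2 z := by
  rw [logPart, shuffle_replicate, Finset.sum_mul]
  refine Finset.sum_congr rfl fun ij hij => ?_
  obtain ⟨i, j⟩ := ij
  rw [Finset.HasAntidiagonal.mem_antidiagonal] at hij
  subst hij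
  simp only [logPart]
  have hi : (i.factorial : ℂ) ≠ 0 := by exact_mod_cast i.factorial_ne_zero
  have hj : (j.factorial : ℂ) ≠ 0 := by exact_mod_cast j.factorial_ne_zero
  have hij : ((i + j).factorial : ℂ) ≠ 0 := by exact_mod_cast (i + j).factorial_ne_zero
  have h : ((i + j).choose i : ℂ) * i.factorial * j.factorial = (i + j).factorial := by
    rw [Nat.choose_symm_add]
    exact_mod_cast Nat.add_choose_mul_factorial_mul_factorial i j
  have h' : ((i + j).choose i : ℂ) / (i + j).factorial = 1 / (i.factorial * j.factorial) := by
    rw [div_eq_div_iff hij (mul_ne_zero hi hj), ← h]; ring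
  calc _ = ((i + j).choose i : ℂ) / (i + j).factorial * (S (List.replicate i 0) *
        T (List.replicate j 0) * (Complex.log z ^ i * Complex.log z ^ j)) := by
        rw [pow_add]; ring
    _ = _ := by rw [h']; field_simp

theorem rayBound_LiHom_sub_logPart (S : NCSeries) (n : ℕ) :
    RayBound (fun z => LiHom S n z - logPart S n z) (2 / 3) := by
  have h1 : ∀ z, LiHom S n z - logPart S n z =
      ∑ w : List.Vector (Fin 2) n, if 1 ∈ w.toList then S w.toList * LiWord w.toList z else 0 := by
    intro z
    rw [LiHom_eq_wordSum, wordSum_eq_replicate_add, LiWord_of_one_notMem (by simp), logPart,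
      List.length_replicate, add_sub_cancel_left]
    rfl
  simp only [h1]
  refine RayBound.sum _ fun w _ => ?_
  split_ifs with h
  · exact (rayBound_LiWord_of_one_mem h).1.const_mul _
  · exact rayBound_zero _

/-- A function on `Ω` with zero derivative that vanishes at the origin along rays is zero. -/
theorem eq_zero_of_hasDerivAt_zero {D : ℂ → ℂ} (hD : ∀ z ∈ Ω, HasDerivAt D 0 z) {e : ℝ}
    (he : 0 < e) (hb : RayBound D e) {z : ℂ} (hz : z ∈ Ω) : D z = 0 := by
  have h0 : ∀ t ∈ Set.Ioc (0 : ℝ) 1, HasDerivAt (fun t : ℝ => D ((t : ℂ) * z)) 0 t := by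
    intro t ht
    have h1 : HasDerivAt (fun t : ℝ => (t : ℂ)) 1 t := Complex.ofRealCLM.hasDerivAt
    exact ((hD _ (ray_mem hz ht)).comp t (h1.mul_const z)).congr_deriv (by simp)
  have h1 := integral_eq_sub_of_hasDerivAt_of_tendsto (f := fun t : ℝ => D ((t : ℂ) * z))
    (f' := fun _ => 0) (fa := 0) (fb := D z) zero_lt_one
    (fun t ht => h0 t ⟨ht.1, ht.2.le⟩) intervalIntegrable_const (hb.tendsto_zero he hz) ?_
  · simpa using h1.symm
  · have h2 := (h0 1 (by simp)).continuousAt.tendsto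
    simp only [Complex.ofReal_one, one_mul] at h2
    exact h2.mono_left nhdsWithin_le_nhds

/-- After the purely logarithmic terms cancel, every remaining product has a factor built from words
containing `x₁`. The worst exponent is `2/3 - 1/3 = 1/3`, which is still positive. -/
theorem rayBound_LiHom_shuffle_sub (S T : NCSeries) (n : ℕ) :
    RayBound (fun z => LiHom (shuffle S T) n z -
      ∑ ij ∈ Finset.HasAntidiagonal.antidiagonal n, LiHom S ij.1 z * LiHom T ij.2 z) (1 / 3) := by
  have h1 : ∀ z, LiHom (shuffle S T) n z -
      ∑ ij ∈ Finset.HasAntidiagonal.antidiagonal n, LiHom S ij.1 z * LiHom T ij.2 z =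
      (LiHom (shuffle S T) n z - logPart (shuffle S T) n z) +
      ∑ ij ∈ Finset.HasAntidiagonal.antidiagonal n, (-1) * (
        (LiHom S ij.1 z - logPart S ij.1 z) * logPart T ij.2 z +
        logPart S ij.1 z * (LiHom T ij.2 z - logPart T ij.2 z) +
        (LiHom S ij.1 z - logPart S ij.1 z) * (LiHom T ij.2 z - logPart T ij.2 z)) := by
    intro z
    rw [logPart_shuffle, sub_add_eq_add_sub, sub_eq_sub_iff_add_eq_add, add_assoc]
    congr 1
    rw [← Finset.sum_add_distrib]
    exact Finset.sum_congr rfl fun ij _ => by ring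
  simp only [h1]
  refine ((rayBound_LiHom_sub_logPart _ n).mono (by norm_num)).add
    (RayBound.sum _ fun ij _ => RayBound.const_mul (.add (.add ?_ ?_) ?_) _)
  · exact ((rayBound_LiHom_sub_logPart S _).mul (rayBound_logPart T _)).mono (by norm_num)
  · exact ((rayBound_logPart S _).mul (rayBound_LiHom_sub_logPart T _)).mono (by norm_num)
  · exact ((rayBound_LiHom_sub_logPart S _).mul (rayBound_LiHom_sub_logPart T _)).mono
      (by norm_num)

theorem LiHom_shuffle (S T : NCSeries) (n : ℕ) {z : ℂ} (hz : z ∈ Ω) :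
    LiHom (shuffle S T) n z =
      ∑ ij ∈ Finset.HasAntidiagonal.antidiagonal n, LiHom S ij.1 z * LiHom T ij.2 z := by
  induction n generalizing S T z with
  | zero => simp [LiHom_zero, shuffle_nil]
  | succ n ih =>
    rw [← sub_eq_zero]
    refine eq_zero_of_hasDerivAt_zero (fun y hy => ?_) (by norm_num)
      (rayBound_LiHom_shuffle_sub S T (n + 1)) hz
    refine ((hasDerivAt_LiHom _ _ hy).sub (HasDerivAt.fun_sum fun ij _ =>
      (hasDerivAt_LiHom S ij.1 hy).mul (hasDerivAt_LiHom T ij.2 hy))).congr_deriv ?_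
    have h1 : ∀ a, leftDeriv a (shuffle S T) =
        shuffle (leftDeriv a S) T + shuffle S (leftDeriv a T) :=
      fun a => funext fun w => shuffle_cons S T a w
    -- The component of degree `0` is constant. Dropping its derivative from each half of the
    -- Leibniz rule leaves sums over `antidiagonal n`, to which the induction hypothesis applies
    -- with left derivatives in place of `S` or `T`.
    rw [Finset.sum_add_distrib, Finset.Nat.sum_antidiagonal_succ,
      Finset.Nat.sum_antidiagonal_succ' (f := fun ij => LiHom S ij.1 y * derivLiHom T ij.2 y)]
    simp only [derivLiHom, h1, LiHom_add, ih _ _ hy, zero_mul, mul_zero, zero_add, add_mul,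
      Finset.sum_mul, Finset.mul_sum, Finset.sum_add_distrib]
    rw [Finset.sum_comm, Finset.sum_comm (s := Finset.univ), sub_eq_zero]
    congr 1 <;> exact Finset.sum_congr rfl fun _ _ => Finset.sum_congr rfl fun _ _ => by ring

end Polylog

/-! ### Uniform absolute convergence and Cauchy products -/

namespace Polylog

open Topology NCSeries

/-- Splitting into real and imaginary parts, then by sign, gives four subsums without cancellation;
hence the factor `4`. -/
theorem sum_norm_le_of_forall_subset {ι : Type*} (f : ι → ℂ) (s : Finset ι) {c : ℝ}
    (h : ∀ t ⊆ s, ‖∑ i ∈ t, f i‖ ≤ c) : ∑ i ∈ s, ‖f i‖ ≤ 4 * c := by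
  have key : ∀ g : ι → ℝ, (∀ t ⊆ s, |∑ i ∈ t, g i| ≤ c) → ∑ i ∈ s, |g i| ≤ 2 * c := by
    intro g hg
    rw [← Finset.sum_filter_add_sum_filter_not s (fun i => 0 ≤ g i), two_mul]
    refine add_le_add ?_ ?_
    · rw [Finset.sum_congr rfl fun i hi => abs_of_nonneg (Finset.mem_filter.1 hi).2]
      exact (le_abs_self _).trans (hg _ (Finset.filter_subset _ _))
    · rw [Finset.sum_congr rfl fun i hi => abs_of_neg (not_le.1 (Finset.mem_filter.1 hi).2),
        Finset.sum_neg_distrib]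
      exact (neg_le_abs _).trans (hg _ (Finset.filter_subset _ _))
  have h1 := key (fun i => (f i).re) fun t ht => by
    rw [← Complex.re_sum]; exact (Complex.abs_re_le_norm _).trans (h t ht)
  have h2 := key (fun i => (f i).im) fun t ht => by
    rw [← Complex.im_sum]; exact (Complex.abs_im_le_norm _).trans (h t ht)
  have h3 : ∑ i ∈ s, ‖f i‖ ≤ ∑ i ∈ s, (|(f i).re| + |(f i).im|) :=
    Finset.sum_le_sum fun i _ => Complex.norm_le_abs_re_add_abs_im _
  rw [Finset.sum_add_distrib] at h3
  linarith

/-- Uniform Cauchy criterion for the absolute convergence of `∑ fₙ` on `K`. -/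
def UniformAbsCauchyOn (f : ℕ → ℂ → ℂ) (K : Set ℂ) : Prop :=
  ∀ ε > 0, ∃ s₀ : Finset ℕ, ∀ s : Finset ℕ, Disjoint s s₀ → ∀ z ∈ K, ∑ n ∈ s, ‖f n z‖ ≤ ε

theorem uniformAbsCauchyOn_of_tendstoUniformlyOn {f : ℕ → ℂ → ℂ} {F : ℂ → ℂ} {K : Set ℂ}
    (h : TendstoUniformlyOn (fun (s : Finset ℕ) (z : ℂ) => ∑ n ∈ s, f n z) F atTop K) :
    UniformAbsCauchyOn f K := by
  intro ε hε
  -- Two partial sums within `ε / 8` of `F` bound each subsum off `s₀` by `ε / 4`; the factor `4`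
  -- above restores `ε`.
  obtain ⟨s₀, hs₀⟩ := eventually_atTop.1 (Metric.tendstoUniformlyOn_iff.1 h (ε / 8) (by positivity))
  refine ⟨s₀, fun s hs z hz => ?_⟩
  refine (sum_norm_le_of_forall_subset (fun n => f n z) s (c := ε / 4) fun t ht => ?_).trans
    (le_of_eq (by ring))
  have h1 := hs₀ (t ∪ s₀) Finset.subset_union_right z hz
  have h2 := hs₀ s₀ le_rfl z hz
  rw [Finset.sum_union (hs.mono_left ht)] at h1
  have h3 := dist_triangle_left (∑ n ∈ t, f n z + ∑ n ∈ s₀, f n z) (∑ n ∈ s₀, f n z) (F z)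
  rw [dist_eq_norm (_ + _), add_sub_cancel_right] at h3
  linarith

theorem UniformAbsCauchyOn.exists_bound {f : ℕ → ℂ → ℂ} {K : Set ℂ} (hf : UniformAbsCauchyOn f K)
    (hK : IsCompact K) (hc : ∀ n, ContinuousOn (f n) K) :
    ∃ M : ℝ, 0 ≤ M ∧ ∀ s : Finset ℕ, ∀ z ∈ K, ∑ n ∈ s, ‖f n z‖ ≤ M := by
  obtain ⟨s₀, hs₀⟩ := hf 1 one_pos
  choose C hC using fun n => hK.exists_bound_of_continuousOn (hc n)
  refine ⟨∑ n ∈ s₀, max (C n) 0 + 1,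
    add_nonneg (Finset.sum_nonneg fun _ _ => le_max_right _ _) zero_le_one, fun s z hz => ?_⟩
  rw [← Finset.sum_sdiff (Finset.inter_subset_left : s ∩ s₀ ⊆ s), add_comm]
  refine add_le_add ?_ (hs₀ _ (by simp [Finset.disjoint_left]) z hz)
  calc ∑ n ∈ s ∩ s₀, ‖f n z‖ ≤ ∑ n ∈ s ∩ s₀, max (C n) 0 :=
        Finset.sum_le_sum fun n _ => (hC n z hz).trans (le_max_left _ _)
    _ ≤ _ := Finset.sum_le_sum_of_subset_of_nonneg Finset.inter_subset_right
        fun _ _ _ => le_max_right _ _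

theorem UniformAbsCauchyOn.tendstoUniformlyOn {f : ℕ → ℂ → ℂ} {F : ℂ → ℂ} {K : Set ℂ}
    (hf : UniformAbsCauchyOn f K) (hF : ∀ z ∈ K, HasSum (fun n => f n z) (F z)) :
    TendstoUniformlyOn (fun (s : Finset ℕ) (z : ℂ) => ∑ n ∈ s, f n z) F atTop K := by
  rw [Metric.tendstoUniformlyOn_iff]
  intro ε hε
  obtain ⟨s₀, hs₀⟩ := hf (ε / 2) (by positivity)
  filter_upwards [eventually_ge_atTop s₀] with s hs z hz
  refine lt_of_le_of_lt ?_ (half_lt_self hε)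
  rw [dist_eq_norm]
  refine le_of_tendsto ((hF z hz).sub_const _).norm ?_
  filter_upwards [eventually_ge_atTop s] with t ht
  rw [← Finset.sum_sdiff ht, add_sub_cancel_right]
  refine (norm_sum_le _ _).trans (hs₀ _ ?_ z hz)
  exact Finset.disjoint_of_subset_right hs Finset.sdiff_disjoint

/-- If `i + j ≥ 2N`, then `i ≥ N` or `j ≥ N`, so the tail of the Cauchy product lies in two
rectangles, each a tail times a partial sum. -/
theorem sum_sum_antidiagonal_le {a b : ℕ → ℝ} (ha : ∀ n, 0 ≤ a n) (hb : ∀ n, 0 ≤ b n) {N : ℕ}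
    {u : Finset ℕ} (hu : ∀ n ∈ u, 2 * N ≤ n) :
    ∃ B, ∑ n ∈ u, ∑ ij ∈ Finset.HasAntidiagonal.antidiagonal n, a ij.1 * b ij.2 ≤
      (∑ i ∈ Finset.Ico N B, a i) * ∑ j ∈ Finset.range B, b j +
      (∑ i ∈ Finset.range B, a i) * ∑ j ∈ Finset.Ico N B, b j := by
  classical
  refine ⟨u.sup id + 1, ?_⟩
  set B := u.sup id + 1 with hB
  have hlt : ∀ n ∈ u, n < B := fun n hn => Nat.lt_succ_of_le (Finset.le_sup (f := id) hn)
  have hpos : ∀ p : ℕ × ℕ, 0 ≤ a p.1 * b p.2 := fun p => mul_nonneg (ha _) (hb _)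
  rw [Finset.sum_mul_sum, Finset.sum_mul_sum, ← Finset.sum_product', ← Finset.sum_product',
    Finset.sum_sigma']
  have h1 : ∑ x ∈ u.sigma fun n => Finset.HasAntidiagonal.antidiagonal n,
      a x.2.1 * b x.2.2 = ∑ p ∈ (u.sigma fun n => Finset.HasAntidiagonal.antidiagonal n).image
        Sigma.snd, a p.1 * b p.2 := by
    rw [Finset.sum_image]
    rintro ⟨n, i, j⟩ h ⟨n', i', j'⟩ h' heq
    simp only [Finset.coe_sigma, Set.mem_sigma_iff, Finset.mem_coe,
      Finset.HasAntidiagonal.mem_antidiagonal] at h h'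
    obtain ⟨rfl, rfl⟩ := Prod.mk.inj heq
    obtain rfl : n = n' := h.2.symm.trans h'.2
    rfl
  rw [h1]
  refine (Finset.sum_le_sum_of_subset_of_nonneg (t := Finset.Ico N B ×ˢ Finset.range B ∪
    Finset.range B ×ˢ Finset.Ico N B) ?_ fun p _ _ => hpos p).trans ?_
  · rintro ⟨i, j⟩ hp
    simp only [Finset.mem_image, Finset.mem_sigma, Finset.HasAntidiagonal.mem_antidiagonal] at hp
    obtain ⟨⟨n, p⟩, ⟨hn, hs⟩, rfl⟩ := hp
    have := hu n hn
    have := hlt n hn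
    simp only at hs
    simp only [Finset.mem_union, Finset.mem_product, Finset.mem_Ico, Finset.mem_range]
    omega
  · rw [← Finset.sum_union_inter]
    exact le_add_of_nonneg_right (Finset.sum_nonneg fun p _ => hpos p)

theorem UniformAbsCauchyOn.cauchyProduct {f g : ℕ → ℂ → ℂ} {K : Set ℂ} (hK : IsCompact K)
    (hf : UniformAbsCauchyOn f K) (hg : UniformAbsCauchyOn g K)
    (hfc : ∀ n, ContinuousOn (f n) K) (hgc : ∀ n, ContinuousOn (g n) K) :
    UniformAbsCauchyOn (fun n z =>
      ∑ ij ∈ Finset.HasAntidiagonal.antidiagonal n, f ij.1 z * g ij.2 z) K := by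
  obtain ⟨M, hM0, hM⟩ := hf.exists_bound hK hfc
  obtain ⟨M', hM0', hM'⟩ := hg.exists_bound hK hgc
  intro ε hε
  set δ := ε / (M + M' + 1) with hδ
  have hδ0 : 0 < δ := by positivity
  obtain ⟨s₁, hs₁⟩ := hf δ hδ0
  obtain ⟨s₂, hs₂⟩ := hg δ hδ0
  set N := (s₁ ∪ s₂).sup id + 1 with hN
  have hlt : ∀ n ∈ s₁ ∪ s₂, n < N := fun n hn => Nat.lt_succ_of_le (Finset.le_sup (f := id) hn)
  have hd : ∀ B, Disjoint (Finset.Ico N B) (s₁ ∪ s₂) := fun B =>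
    Finset.disjoint_left.2 fun n hn hn' => (hlt n hn').not_ge (Finset.mem_Ico.1 hn).1
  refine ⟨Finset.range (2 * N), fun u hu z hz => ?_⟩
  obtain ⟨B, hB⟩ := sum_sum_antidiagonal_le (a := fun n => ‖f n z‖) (b := fun n => ‖g n z‖)
    (fun _ => norm_nonneg _) (fun _ => norm_nonneg _) (N := N) (u := u) fun n hn => by
      simpa using Finset.disjoint_left.1 hu hn
  calc _ ≤ ∑ n ∈ u, ∑ ij ∈ Finset.HasAntidiagonal.antidiagonal n, ‖f ij.1 z‖ * ‖g ij.2 z‖ :=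
        Finset.sum_le_sum fun n _ => (norm_sum_le _ _).trans_eq (by simp only [norm_mul])
    _ ≤ _ := hB
    _ ≤ δ * M' + M * δ := by
        refine add_le_add (mul_le_mul ?_ (hM' _ z hz) (Finset.sum_nonneg fun _ _ => norm_nonneg _)
          hδ0.le) (mul_le_mul (hM _ z hz) ?_ (Finset.sum_nonneg fun _ _ => norm_nonneg _) hM0)
        · exact hs₁ _ ((hd B).mono_right Finset.subset_union_left) z hz
        · exact hs₂ _ ((hd B).mono_right Finset.subset_union_right) z hz
    _ ≤ δ * (M + M' + 1) := by nlinarith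
    _ = ε := by rw [hδ]; field_simp

theorem hasSum_LiHom {S : NCSeries} {F : ℂ → ℂ} (h : ∀ K ⊆ Ω, IsCompact K →
    TendstoUniformlyOn (fun (s : Finset ℕ) (z : ℂ) => ∑ n ∈ s, LiHom S n z) F atTop K)
    {z : ℂ} (hz : z ∈ Ω) : HasSum (fun n => LiHom S n z) (F z) :=
  (h {z} (by simpa using hz) isCompact_singleton).tendsto_at rfl

theorem hasSum_LiHom_shuffle {S T : NCSeries} {z F G : ℂ} (hz : z ∈ Ω)
    (hS : HasSum (fun n => LiHom S n z) F) (hT : HasSum (fun n => LiHom T n z) G) :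
    HasSum (fun n => LiHom (shuffle S T) n z) (F * G) := by
  simp only [LiHom_shuffle S T _ hz]
  have h1 := summable_norm_sum_mul_antidiagonal_of_summable_norm hS.summable.norm hT.summable.norm
  rw [← hS.tsum_eq, ← hT.tsum_eq, tsum_mul_tsum_eq_tsum_sum_antidiagonal_of_summable_norm
    hS.summable.norm hT.summable.norm]
  exact h1.of_norm.hasSum

theorem shuffle_mem_DomLi {S T : NCSeries} (hS : S ∈ DomLi) (hT : T ∈ DomLi) :
    shuffle S T ∈ DomLi := by
  obtain ⟨F, hFd, hF⟩ := hS
  obtain ⟨G, hGd, hG⟩ := hT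
  refine ⟨fun z => F z * G z, hFd.mul hGd, fun K hK hKc => ?_⟩
  have h1 := (uniformAbsCauchyOn_of_tendstoUniformlyOn (hF K hK hKc)).cauchyProduct hKc
    (uniformAbsCauchyOn_of_tendstoUniformlyOn (hG K hK hKc))
    (fun n => (differentiableOn_LiHom S n).continuousOn.mono hK)
    (fun n => (differentiableOn_LiHom T n).continuousOn.mono hK)
  refine UniformAbsCauchyOn.tendstoUniformlyOn ?_ fun z hz =>
    hasSum_LiHom_shuffle (hK hz) (hasSum_LiHom hF (hK hz)) (hasSum_LiHom hG (hK hz))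
  intro ε hε
  obtain ⟨s₀, hs₀⟩ := h1 ε hε
  refine ⟨s₀, fun s hs z hz => ?_⟩
  simp only [LiHom_shuffle S T _ (hK hz)]
  exact hs₀ s hs z hz

theorem LiSeries_shuffle {S T : NCSeries} (hS : S ∈ DomLi) (hT : T ∈ DomLi) {z : ℂ}
    (hz : z ∈ Ω) : LiSeries (shuffle S T) z = LiSeries S z * LiSeries T z := by
  obtain ⟨F, -, hF⟩ := hS
  obtain ⟨G, -, hG⟩ := hT
  have h1 := hasSum_LiHom hF hz
  have h2 := hasSum_LiHom hG hz
  rw [LiSeries, LiSeries, LiSeries, h1.tsum_eq, h2.tsum_eq, (hasSum_LiHom_shuffle hz h1 h2).tsum_eq]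

end Polylog

/-! ### Geometric growth of rational series -/

namespace NCSeries

/-- The words of `S` have their letters in `Y` and the coefficients of `S` grow at most
geometrically with the length of the words. -/
def GeometricOn (Y : Set (Fin 2)) (S : NCSeries) : Prop :=
  (∀ w, S w ≠ 0 → ∀ a ∈ w, a ∈ Y) ∧
    ∃ C r : ℝ, 0 ≤ C ∧ 0 ≤ r ∧ ∀ w, ‖S w‖ ≤ C * r ^ w.length

variable {Y : Set (Fin 2)} {S T : NCSeries}

theorem GeometricOn.of_polynomial (hP : IsPolynomial S) (hY : ∀ w, S w ≠ 0 → ∀ a ∈ w, a ∈ Y) :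
    GeometricOn Y S := by
  refine ⟨hY, ∑ w ∈ hP.toFinset, ‖S w‖, 1, Finset.sum_nonneg fun _ _ => norm_nonneg _,
    zero_le_one, fun w => ?_⟩
  rw [one_pow, mul_one]
  by_cases h : S w = 0
  · rw [h, norm_zero]
    exact Finset.sum_nonneg fun _ _ => norm_nonneg _
  · exact Finset.single_le_sum (f := fun w => ‖S w‖) (fun _ _ => norm_nonneg _)
      (hP.mem_toFinset.2 h)

theorem GeometricOn.add (hS : GeometricOn Y S) (hT : GeometricOn Y T) :
    GeometricOn Y (S + T) := by
  obtain ⟨hSY, C, r, hC, hr, hS⟩ := hS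
  obtain ⟨hTY, D, q, hD, hq, hT⟩ := hT
  refine ⟨fun w hw => ?_, C + D, max r q, by positivity, le_max_of_le_left hr, fun w => ?_⟩
  · by_cases h : S w = 0
    · exact hTY w fun h' => hw (by simp [h, h'])
    · exact hSY w h
  · rw [add_mul]
    refine (norm_add_le _ _).trans (add_le_add ((hS w).trans ?_) ((hT w).trans ?_))
    · gcongr; exact le_max_left _ _
    · gcongr; exact le_max_right _ _

theorem conc_support (hS : ∀ w, S w ≠ 0 → ∀ a ∈ w, a ∈ Y) (hT : ∀ w, T w ≠ 0 → ∀ a ∈ w, a ∈ Y)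
    (w : List (Fin 2)) (hw : conc S T w ≠ 0) : ∀ a ∈ w, a ∈ Y := by
  obtain ⟨i, -, hi⟩ := Finset.exists_ne_zero_of_sum_ne_zero hw
  intro a ha
  rw [← List.take_append_drop i w, List.mem_append] at ha
  exact ha.elim (hS _ (left_ne_zero_of_mul hi) a) (hT _ (right_ne_zero_of_mul hi) a)

theorem concPow_support (hS : ∀ w, S w ≠ 0 → ∀ a ∈ w, a ∈ Y) (n : ℕ) :
    ∀ w, concPow S n w ≠ 0 → ∀ a ∈ w, a ∈ Y := by
  induction n with
  | zero =>
    intro w hw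
    obtain rfl : w = [] := by simpa [concPow, one] using hw
    simp
  | succ n ih => exact conc_support hS ih

theorem natCast_succ_le_two_pow (n : ℕ) : ((n + 1 : ℕ) : ℝ) ≤ 2 ^ n := by
  exact_mod_cast Nat.lt_two_pow_self

/-- The `|w| + 1` factorizations of `w` are absorbed by doubling the ratio. -/
theorem GeometricOn.conc (hS : GeometricOn Y S) (hT : GeometricOn Y T) :
    GeometricOn Y (conc S T) := by
  obtain ⟨hSY, C, r, hC, hr, hS⟩ := hS
  obtain ⟨hTY, D, q, hD, hq, hT⟩ := hT
  refine ⟨conc_support hSY hTY, C * D, 2 * max r q, by positivity,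
    mul_nonneg zero_le_two (le_max_of_le_left hr), fun w => ?_⟩
  have hR : 0 ≤ max r q := le_max_of_le_left hr
  have h1 : ∀ i ∈ Finset.range (w.length + 1),
      ‖S (w.take i) * T (w.drop i)‖ ≤ C * D * max r q ^ w.length := by
    intro i hi
    have hi' : i ≤ w.length := Nat.lt_succ_iff.1 (Finset.mem_range.1 hi)
    have h2 := hS (w.take i)
    have h3 := hT (w.drop i)
    rw [List.length_take_of_le hi'] at h2
    rw [List.length_drop] at h3
    rw [norm_mul]
    calc _ ≤ (C * r ^ i) * (D * q ^ (w.length - i)) :=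
          mul_le_mul h2 h3 (norm_nonneg _) (by positivity)
      _ ≤ (C * max r q ^ i) * (D * max r q ^ (w.length - i)) := by
          gcongr
          · exact le_max_left _ _
          · exact le_max_right _ _
      _ = C * D * (max r q ^ i * max r q ^ (w.length - i)) := by ring
      _ = _ := by rw [← pow_add, Nat.add_sub_cancel' hi']
  refine (norm_sum_le_of_le _ h1).trans ?_
  rw [Finset.sum_const, Finset.card_range, nsmul_eq_mul, mul_pow, mul_left_comm]
  gcongr
  exact natCast_succ_le_two_pow _

/-- The bound is uniform in `k`, so that the star can sum `|w| + 1` powers at the cost of another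
factor `2` in the ratio. It propagates because the missing constant term leaves `C ∑_{j < n} (C +
1)^j = (C + 1)^n - 1`. -/
theorem norm_concPow_le {C r : ℝ} (hC : 0 ≤ C) (hr : 0 ≤ r) (hS : ∀ w, ‖S w‖ ≤ C * r ^ w.length)
    (h0 : S [] = 0) (k : ℕ) (w : List (Fin 2)) :
    ‖concPow S k w‖ ≤ (r * (C + 1)) ^ w.length := by
  induction k generalizing w with
  | zero =>
    by_cases h : w = []
    · simp [concPow, one, h]
    · simp only [concPow, one, h, if_false, norm_zero]
      positivity
  | succ k ih =>
    simp only [concPow, NCSeries.conc]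
    rw [Finset.sum_range_succ', List.take_zero, h0, zero_mul, add_zero]
    have h1 : ∀ i ∈ Finset.range w.length,
        ‖S (w.take (i + 1)) * concPow S k (w.drop (i + 1))‖ ≤
          r ^ w.length * C * (C + 1) ^ (w.length - 1 - i) := by
      intro i hi
      have hi' : i + 1 ≤ w.length := Finset.mem_range.1 hi
      have h2 := hS (w.take (i + 1))
      have h3 := ih (w.drop (i + 1))
      rw [List.length_take_of_le hi'] at h2
      rw [List.length_drop] at h3
      rw [norm_mul]
      calc _ ≤ (C * r ^ (i + 1)) * (r * (C + 1)) ^ (w.length - (i + 1)) :=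
            mul_le_mul h2 h3 (norm_nonneg _) (by positivity)
        _ = (r ^ (i + 1) * r ^ (w.length - (i + 1))) * C * (C + 1) ^ (w.length - (i + 1)) := by
            rw [mul_pow]; ring
        _ = _ := by
            rw [← pow_add, Nat.add_sub_cancel' hi', Nat.sub_sub, add_comm 1 i]
    refine (norm_sum_le_of_le _ h1).trans ?_
    rw [← Finset.mul_sum, Finset.sum_range_reflect (fun i => (C + 1) ^ i) w.length, mul_assoc]
    have h2 := geom_sum_mul (C + 1) w.length
    rw [add_sub_cancel_right, mul_comm] at h2
    rw [h2, mul_pow]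
    exact mul_le_mul_of_nonneg_left (by linarith) (by positivity)

theorem GeometricOn.star (hS : GeometricOn Y S) (h0 : S [] = 0) : GeometricOn Y (star S) := by
  obtain ⟨hSY, C, r, hC, hr, hS⟩ := hS
  refine ⟨fun w hw => ?_, 1, 2 * (r * (C + 1)), zero_le_one, by positivity, fun w => ?_⟩
  · obtain ⟨n, -, hn⟩ := Finset.exists_ne_zero_of_sum_ne_zero hw
    exact concPow_support hSY n w hn
  · refine (norm_sum_le_of_le _ fun n _ => norm_concPow_le hC hr hS h0 n w).trans ?_
    rw [Finset.sum_const, Finset.card_range, nsmul_eq_mul, one_mul, mul_pow 2]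
    gcongr
    exact natCast_succ_le_two_pow _

theorem IsRational.geometricOn (hS : IsRational Y S) : GeometricOn Y S := by
  induction hS with
  | polynomial P hP hY => exact .of_polynomial hP hY
  | add S T _ _ hS hT => exact hS.add hT
  | conc S T _ _ hS hT => exact hS.conc hT
  | star S _ h0 hS => exact hS.star h0

end NCSeries

/-! ### Membership of polynomials and one-letter rational series in the domain -/

namespace Polylog

open Topology MeasureTheory intervalIntegral NCSeries

/-- Weierstrass test; the limit is holomorphic as a locally uniform limit of holomorphic functions.
-/
theorem mem_DomLi_of_summable_bound {S : NCSeries}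
    (h : ∀ K ⊆ Ω, IsCompact K → ∃ u : ℕ → ℝ, Summable u ∧ ∀ n, ∀ z ∈ K, ‖LiHom S n z‖ ≤ u n) :
    S ∈ DomLi := by
  have h1 : ∀ K ⊆ Ω, IsCompact K → TendstoUniformlyOn
      (fun (s : Finset ℕ) (z : ℂ) => ∑ n ∈ s, LiHom S n z) (LiSeries S) atTop K := by
    intro K hK hKc
    obtain ⟨u, hu, hb⟩ := h K hK hKc
    exact tendstoUniformlyOn_tsum hu hb
  refine ⟨LiSeries S, ?_, h1⟩
  exact ((tendstoLocallyUniformlyOn_iff_forall_isCompact isOpen_Ω).2 h1).differentiableOn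
    (Eventually.of_forall fun s => DifferentiableOn.fun_sum fun n _ => differentiableOn_LiHom S n)
    isOpen_Ω

theorem mem_DomLi_of_isPolynomial {P : NCSeries} (hP : IsPolynomial P) : P ∈ DomLi := by
  refine mem_DomLi_of_summable_bound fun K hK hKc => ?_
  choose C hC using fun n => hKc.exists_bound_of_continuousOn
    ((differentiableOn_LiHom P n).continuousOn.mono hK)
  set N := hP.toFinset.sup List.length with hN
  refine ⟨fun n => if n ∈ Finset.range (N + 1) then C n else 0,
    summable_of_ne_finset_zero (s := Finset.range (N + 1)) fun n hn => if_neg hn,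
    fun n z hz => ?_⟩
  beta_reduce
  split_ifs with h
  · exact hC n z hz
  · rw [LiHom, Finset.sum_eq_zero fun w _ => ?_, norm_zero]
    suffices P w.toList = 0 by rw [this, zero_mul]
    by_contra hw
    have h2 : w.toList.length ≤ N :=
      Finset.le_sup (f := List.length) (hP.mem_toFinset.2 hw)
    rw [List.Vector.toList_length] at h2
    exact h (Finset.mem_range.2 (Nat.lt_succ_of_le h2))

theorem LiHom_of_support_singleton {a : Fin 2} {S : NCSeries}
    (hS : ∀ w, S w ≠ 0 → ∀ b ∈ w, b ∈ ({a} : Set (Fin 2))) (n : ℕ) (z : ℂ) :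
    LiHom S n z = S (List.replicate n a) * LiWord (List.replicate n a) z := by
  let v : List.Vector (Fin 2) n := ⟨List.replicate n a, List.length_replicate⟩
  rw [LiHom, Finset.sum_eq_single v]
  · rfl
  · intro w _ hw
    suffices S w.toList = 0 by rw [this, zero_mul]
    by_contra h
    refine hw (Subtype.ext ?_)
    exact List.eq_replicate_iff.2 ⟨w.2, fun b hb => hS _ h b hb⟩
  · simp

theorem exists_bound_LiWord_replicate_one {K : Set ℂ} (hK : K ⊆ Ω) (hKc : IsCompact K) :
    ∃ M : ℝ, 0 ≤ M ∧ ∀ n, ∀ z ∈ K, ‖LiWord (List.replicate n 1) z‖ ≤ M ^ n / n.factorial := by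
  obtain ⟨C, hC0, hC⟩ := exists_bound_one_sub_ray hK hKc
  obtain ⟨R, hR⟩ := hKc.isBounded.exists_norm_le
  set M := max R 0 * C with hM
  have hM0 : 0 ≤ M := by positivity
  -- The factor `s ^ n` strengthens the induction: integrating `t ^ n` yields the `1 / (n + 1)` that
  -- builds the factorial.
  suffices h : ∀ n, ∀ z ∈ K, ∀ s ∈ Set.Icc (0 : ℝ) 1,
      ‖LiWord (List.replicate n 1) ((s : ℂ) * z)‖ ≤ (M * s) ^ n / n.factorial from
    ⟨M, hM0, fun n z hz => by simpa using h n z hz 1 (by simp)⟩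
  intro n z hz
  induction n with
  | zero => intro s _; simp [LiWord]
  | succ n ih =>
    intro s hs
    simp only [List.replicate_succ, LiWord, if_true]
    have hi : IntervalIntegrable (fun t : ℝ => (M * s) ^ (n + 1) / n.factorial * t ^ n)
        volume 0 1 := (intervalIntegrable_pow n).const_mul _
    refine (norm_integral_le_of_norm_le zero_le_one (Eventually.of_forall ?_) hi).trans ?_
    · intro t ht
      have hts : t * s ∈ Set.Icc (0 : ℝ) 1 :=
        ⟨mul_nonneg ht.1.le hs.1, mul_le_one₀ ht.2 hs.1 hs.2⟩
      have h1 := ih _ hts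
      have h2 := hC z hz _ hts
      have h3 : ‖z‖ ≤ max R 0 := (hR z hz).trans (le_max_left _ _)
      rw [Complex.ofReal_mul, mul_assoc] at h1 h2
      rw [norm_mul, div_eq_mul_one_div ((s : ℂ) * z), norm_mul, norm_mul, Complex.norm_real,
        Real.norm_of_nonneg hs.1]
      have hs0 := hs.1
      have ht0 := ht.1.le
      calc _ ≤ (M * (t * s)) ^ n / n.factorial * (s * max R 0 * C) := by gcongr
        _ = _ := by rw [hM]; ring
    · rw [intervalIntegral.integral_const_mul, integral_pow, Nat.factorial_succ]
      push_cast
      simp only [one_pow, ne_eq, Nat.succ_ne_zero, not_false_eq_true, zero_pow, sub_zero]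
      apply le_of_eq
      have hf : (n.factorial : ℝ) ≠ 0 := by exact_mod_cast n.factorial_ne_zero
      field_simp

theorem exists_bound_LiWord_replicate (a : Fin 2) {K : Set ℂ} (hK : K ⊆ Ω) (hKc : IsCompact K) :
    ∃ M : ℝ, 0 ≤ M ∧ ∀ n, ∀ z ∈ K, ‖LiWord (List.replicate n a) z‖ ≤ M ^ n / n.factorial := by
  by_cases ha : a = 1
  · rw [ha]
    exact exists_bound_LiWord_replicate_one hK hKc
  · have hc : ContinuousOn Complex.log K := fun z hz => (Complex.differentiableAt_log
      (mem_slitPlane_of_mem_Ω (hK hz))).continuousAt.continuousWithinAt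
    obtain ⟨M, hM⟩ := hKc.exists_bound_of_continuousOn hc
    refine ⟨max M 0, le_max_right _ _, fun n z hz => ?_⟩
    rw [LiWord_of_one_notMem (by simp [List.mem_replicate, Ne.symm ha]), List.length_replicate,
      norm_div, norm_pow, Complex.norm_natCast]
    have := (hM z hz).trans (le_max_left _ 0)
    gcongr

theorem mem_DomLi_of_isRational {a : Fin 2} {R : NCSeries} (hR : IsRational {a} R) : R ∈ DomLi := by
  obtain ⟨hsupp, C, r, hC, hr, hb⟩ := hR.geometricOn
  refine mem_DomLi_of_summable_bound fun K hK hKc => ?_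
  obtain ⟨M, hM0, hM⟩ := exists_bound_LiWord_replicate a hK hKc
  refine ⟨fun n => C * ((r * M) ^ n / n.factorial),
    (Real.summable_pow_div_factorial (r * M)).mul_left C, fun n z hz => ?_⟩
  rw [LiHom_of_support_singleton hsupp, norm_mul]
  have h1 := hb (List.replicate n a)
  rw [List.length_replicate] at h1
  calc _ ≤ C * r ^ n * (M ^ n / n.factorial) :=
        mul_le_mul h1 (hM n z hz) (norm_nonneg _) (by positivity)
    _ = C * ((r * M) ^ n / n.factorial) := by rw [mul_pow]; ring

theorem zero_mem_DomLi : (0 : NCSeries) ∈ DomLi :=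
  mem_DomLi_of_summable_bound fun _ _ _ => ⟨0, summable_zero, fun n z _ => by simp [LiHom]⟩

theorem add_mem_DomLi {S T : NCSeries} (hS : S ∈ DomLi) (hT : T ∈ DomLi) : S + T ∈ DomLi := by
  obtain ⟨F, hFd, hF⟩ := hS
  obtain ⟨G, hGd, hG⟩ := hT
  refine ⟨F + G, hFd.add hGd, fun K hK hKc => ?_⟩
  simp only [LiHom_add, Finset.sum_add_distrib]
  exact (hF K hK hKc).add (hG K hK hKc)

theorem smul_mem_DomLi (c : ℂ) {S : NCSeries} (hS : S ∈ DomLi) : c • S ∈ DomLi := by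
  obtain ⟨F, hFd, hF⟩ := hS
  refine ⟨fun z => c * F z, hFd.const_mul c, fun K hK hKc => ?_⟩
  simp only [LiHom_smul, ← Finset.mul_sum]
  exact (uniformContinuous_const_smul c).comp_tendstoUniformlyOn (hF K hK hKc)

theorem polyShuffleRat_subset_DomLi : (polyShuffleRat : Set NCSeries) ⊆ DomLi := by
  intro S hS
  refine Submodule.span_induction ?_ zero_mem_DomLi (fun _ _ _ _ => add_mem_DomLi)
    (fun c _ _ => smul_mem_DomLi c) hS
  rintro _ ⟨P, R₀, R₁, hP, h0, h1, rfl⟩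
  exact shuffle_mem_DomLi (shuffle_mem_DomLi (mem_DomLi_of_isPolynomial hP)
    (mem_DomLi_of_isRational h0)) (mem_DomLi_of_isRational h1)

end Polylog

theorem mainTheorem5 :
    (∀ S ∈ Polylog.DomLi, ∀ T ∈ Polylog.DomLi, NCSeries.shuffle S T ∈ Polylog.DomLi) ∧
    (∀ S ∈ Polylog.DomLi, ∀ T ∈ Polylog.DomLi, ∀ z ∈ Polylog.Ω,
      Polylog.LiSeries (NCSeries.shuffle S T) z =
        Polylog.LiSeries S z * Polylog.LiSeries T z) ∧
    (Polylog.polyShuffleRat : Set NCSeries) ⊆ Polylog.DomLi :=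
  ⟨fun _ hS _ hT => Polylog.shuffle_mem_DomLi hS hT,
    fun _ hS _ hT _ hz => Polylog.LiSeries_shuffle hS hT hz,
    Polylog.polyShuffleRat_subset_DomLi⟩
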